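/- Let $\ell$ be a finite distributive lattice with least element $0$ and greatest element $1$, $0\neq 1$, regarded as a Heyting algebra, with unary operations $T_r$ ($r\in\ell$) given by $T_r(s)=1$ if $s=r$ and $T_r(s)=0$ otherwise. An $\ell$-**VL**-algebra is an algebra $(A,\wedge,\vee,\rightarrow,T_r\,(r\in\ell),0,1)$ such that for all $r,s\in\ell$ and $x,y\in A$: (i) $(A,\wedge,\vee,\rightarrow,0,1)$ is a Heyting algebra; (ii) $T_r(x)\wedge T_s(y)\le T_{r\rightarrow s}(x\rightarrow y)\wedge T_{r\wedge s}(x\wedge y)\wedge T_{r\vee s}(x\vee y)$ and $T_s(x)\le T_{T_r(s)}(T_r(x))$; (iii) $T_0(0)=1$, $T_r(0)=0$ for $r\ne 0$, $T_1(1)=1$, $T_r(1)=0$ for $r\neq 1$; (iv) $\bigvee_{r\in\ell}T_r(x)=1$, $T_r(x)\vee(T_r(x)\rightarrow 0)=1$, and $T_r(x)\wedge T_s(x)=0$ for $r\ne s$; (v) $T_1(T_r(x))=T_r(x)$, $T_0(T_r(x))=T_r(x)\rightarrow 0$, and $T_s(T_r(x))=0$ for $s\ne 0,1$; (vi) $T_1(x)\le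 x$ and $T_1(x\wedge y)=T_1(x)\wedge T_1(y)$; (vii) $\bigwedge_{r\in\ell}(T_r(x)\leftrightarrow T_r(y))\le (x\leftrightarrow y)$. An $\ell$-**ML**-algebra is an $\ell$-**VL**-algebra with a unary operation $\Box$ such that $\Box(x\wedge y)=\Box x\wedge\Box y$, $\Box 1=1$ and $U_r(\Box x)=\Box U_r(x)$ for all $r\in\ell$, where $U_r(x)=\bigvee\{T_s(x): r\le s\}$. Homomorphisms preserve all the operations; $\ell$-MA is the category of $\ell$-**ML**-algebras and their homomorphisms. An $\ell$-Boolean space $(S,\psi)$ is a zero-dimensional compact Hausdorff space $S$ with a map $\psi$ from the subalgebras of the $\ell$-**VL**-algebra $\ell$ to the closed subspaces of $S$ such that $\psi(\ell)=S$ and $\psi(m\cap n)=\psi(m)\cap\psi(n)$. Let $Cont(S,\psi)$ be the set of continuous $f:S\to\ell$ ($\ell$ discrete) with $f(\psi(m))\subseteq m$ for every subalgebra $m$ of $\ell$, with the pointwise operations. An $\ell$-relational space $(S,\psi,R)$ is an $\ell$-Boolean space with a binary relation $R$ such that, with $(\Box_Rf)(x)=\bigwedge\{f(y): xRy\}$,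 (1) if $(\Box_Rf)(x)=1$ implies $f(y)=1$ for all $f\in Cont(S,\psi)$, then $xRy$; (2) if $X\subseteq S$ is clopen, then $R^{-1}[X]=\{s:\exists t\in X,\ sRt\}$ is clopen; (3) if $x\in\psi(m)$, then $R[x]\subseteq\psi(m)$, for every subalgebra $m$ of $\ell$. A morphism $f:(S_1,\psi_1,R_1)\to(S_2,\psi_2,R_2)$ is a continuous map with $f(\psi_1(m))\subseteq\psi_2(m)$ for all $m$, such that $sR_1t$ implies $f(s)R_2f(t)$, and $f(s_1)R_2s_2$ implies that there is $t_1$ with $s_1R_1t_1$ and $f(t_1)=s_2$. These form the category $\ell$-**RS**. (The one-element algebra and the empty space are allowed.) **Theorem.** The categories $\ell$-MA and $\ell$-**RS** are dually equivalent, i.e. $(\ell\text{-MA})^{op}\simeq\ell\text{-}\mathbf{RS}$. More precisely, there is such an equivalence in which * an $\ell$-**ML**-algebra $A$ goes, up to an isomorphism natural in $A$, to the set $Spec_\ell(A)$ of $\ell$-**VL**-homomorphisms $v:A\to\ell$, with the topology generated by the sets $\{v: v(a)=1\}$ ($a\in A$), the subspaces $Spec_m(A)=\{v: v(A)\subseteq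 m\}$ and the relation $vRw\iff\forall r\in\ell\,\forall a\in A\,(v(\Box a)\ge r\Rightarrow w(a)\ge r)$, and a homomorphism $\varphi$ goes to $v\mapsto v\circ\varphi$; * the quasi-inverse is naturally isomorphic to the functor taking $(S,\psi,R)$ to the $\ell$-**ML**-algebra $(Cont(S,\psi),\Box_R)$ and a morphism $f$ to $v\mapsto v\circ f$. -/

import Mathlib

/-!  Throughout, `L` is a finite Heyting algebra.  A finite distributive lattice carries exactly one
Heyting implication, so this is the same thing as a finite distributive lattice. -/

open CategoryTheory

universe u v w x

namespace FittingDuality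

section Algebras

/-- `L`-VL-algebras: a Heyting algebra with unary operations `T r` (`r ∈ L`), to be read as
"the truth value of `x` is exactly `r`", subject to Maruyama's axioms. -/
class VLAlgebra (L : Type u) [HeytingAlgebra L] [Fintype L] (A : Type v) [HeytingAlgebra A] where
  T : L → A → A
  T_ops : ∀ (r s : L) (x y : A),
    T r x ⊓ T s y ≤ T (r ⇨ s) (x ⇨ y) ⊓ T (r ⊓ s) (x ⊓ y) ⊓ T (r ⊔ s) (x ⊔ y)
  T_T_of_eq : ∀ (r s : L) (x : A), s = r → T s x ≤ T ⊤ (T r x)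
  T_T_of_ne : ∀ (r s : L) (x : A), s ≠ r → T s x ≤ T ⊥ (T r x)
  T_bot_bot : T ⊥ ⊥ = ⊤
  T_bot_of_ne : ∀ r : L, r ≠ ⊥ → T r ⊥ = ⊥
  T_top_top : T ⊤ ⊤ = ⊤
  T_top_of_ne : ∀ r : L, r ≠ ⊤ → T r ⊤ = ⊥
  sup_T : ∀ x : A, (Finset.univ.sup fun r : L => T r x) = ⊤
  T_em : ∀ (r : L) (x : A), T r x ⊔ (T r x ⇨ ⊥) = ⊤
  T_inf_of_ne : ∀ (r s : L) (x : A), r ≠ s → T r x ⊓ T s x = ⊥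
  T_top_T : ∀ (r : L) (x : A), T ⊤ (T r x) = T r x
  T_bot_T : ∀ (r : L) (x : A), T ⊥ (T r x) = (T r x ⇨ ⊥)
  T_mid_T : ∀ (r s : L) (x : A), s ≠ ⊥ → s ≠ ⊤ → T s (T r x) = ⊥
  T_top_le : ∀ x : A, T ⊤ x ≤ x
  T_top_inf : ∀ x y : A, T ⊤ (x ⊓ y) = T ⊤ x ⊓ T ⊤ y
  T_ext : ∀ x y : A,
    (Finset.univ.inf fun r : L => (T r x ⇨ T r y) ⊓ (T r y ⇨ T r x)) ≤ (x ⇨ y) ⊓ (y ⇨ x)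

open VLAlgebra

variable (L : Type u) [HeytingAlgebra L] [Fintype L]

open scoped Classical in
/-- `U r x` is the join of all `T s x` with `r ≤ s`: "the truth value of `x` is at least `r`". -/
noncomputable def U {L : Type u} [HeytingAlgebra L] [Fintype L] {A : Type v} [HeytingAlgebra A]
    [VLAlgebra L A] (r : L) (x : A) : A :=
  (Finset.univ.filter fun s : L => r ≤ s).sup fun s => T s x

/-- `L`-ML-algebras. -/
class MLAlgebra (A : Type v) [HeytingAlgebra A] extends VLAlgebra L A where
  box : A → A
  box_inf : ∀ x y : A, box (x ⊓ y) = box x ⊓ box y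
  box_top : box ⊤ = ⊤
  U_box : ∀ (r : L) (x : A), U r (box x) = box (U r x)

/-- Homomorphisms of `L`-VL-algebras. -/
@[ext]
structure VLHom (A : Type v) [HeytingAlgebra A] [VLAlgebra L A]
    (B : Type w) [HeytingAlgebra B] [VLAlgebra L B] where
  toFun : A → B
  map_sup : ∀ x y, toFun (x ⊔ y) = toFun x ⊔ toFun y
  map_inf : ∀ x y, toFun (x ⊓ y) = toFun x ⊓ toFun y
  map_himp : ∀ x y, toFun (x ⇨ y) = toFun x ⇨ toFun y
  map_T : ∀ (r : L) x, toFun (T r x) = T r (toFun x)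
  map_bot : toFun ⊥ = ⊥
  map_top : toFun ⊤ = ⊤

/-- Homomorphisms of `L`-ML-algebras. -/
@[ext]
structure MLHom (A : Type v) [HeytingAlgebra A] [MLAlgebra L A]
    (B : Type w) [HeytingAlgebra B] [MLAlgebra L B] extends VLHom L A B where
  map_box : ∀ x, toFun (MLAlgebra.box L x) = MLAlgebra.box L (toFun x)

variable {L}

/-- Composition of homomorphisms of `L`-VL-algebras. -/
def VLHom.comp {A : Type v} [HeytingAlgebra A] [VLAlgebra L A]
    {B : Type w} [HeytingAlgebra B] [VLAlgebra L B]
    {C : Type x} [HeytingAlgebra C] [VLAlgebra L C]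
    (g : VLHom L B C) (f : VLHom L A B) : VLHom L A C where
  toFun a := g.toFun (f.toFun a)
  map_sup a b := by rw [f.map_sup, g.map_sup]
  map_inf a b := by rw [f.map_inf, g.map_inf]
  map_himp a b := by rw [f.map_himp, g.map_himp]
  map_T r a := by rw [f.map_T, g.map_T]
  map_bot := by rw [f.map_bot, g.map_bot]
  map_top := by rw [f.map_top, g.map_top]

variable (L)

/-- The category of `L`-ML-algebras. -/
structure MLCat where
  carrier : Type u
  [heyting : HeytingAlgebra carrier]
  [ml : MLAlgebra L carrier]

attribute [instance] MLCat.heyting MLCat.ml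

instance : Category (MLCat L) where
  Hom A B := MLHom L A.carrier B.carrier
  id A :=
    { toFun := fun a => a
      map_sup := fun _ _ => rfl
      map_inf := fun _ _ => rfl
      map_himp := fun _ _ => rfl
      map_T := fun _ _ => rfl
      map_bot := rfl
      map_top := rfl
      map_box := fun _ => rfl }
  comp f g :=
    { toVLHom := g.toVLHom.comp f.toVLHom
      map_box := fun a => by
        change g.toFun (f.toFun _) = _
        rw [f.map_box, g.map_box]; rfl }

end Algebras

section TruthValues

open VLAlgebra

variable (L : Type u) [HeytingAlgebra L] [Fintype L]

open scoped Classical in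
/-- On `L` itself, `T r s` is `1` if `s = r` and `0` otherwise. -/
noncomputable instance truthValueAlgebra : VLAlgebra L L where
  T r s := if s = r then ⊤ else ⊥
  T_ops r s x y := by
    by_cases h1 : x = r <;> by_cases h2 : y = s <;> simp [h1, h2]
  T_T_of_eq r s x h := by subst h; by_cases h1 : x = s <;> simp [h1]
  T_T_of_ne r s x h := by
    by_cases h1 : x = s
    · subst h1; simp [h]
    · simp [h1]
  T_bot_bot := by simp
  T_bot_of_ne r h := by simp [Ne.symm h]
  T_top_top := by simp
  T_top_of_ne r h := by simp [Ne.symm h]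
  sup_T x := by
    refine top_le_iff.1 ?_
    have := Finset.le_sup (f := fun r : L => if x = r then (⊤ : L) else ⊥) (Finset.mem_univ x)
    simpa using this
  T_em r x := by by_cases h : x = r <;> simp [h]
  T_inf_of_ne r s x h := by
    by_cases h1 : x = r
    · subst h1; simp [h]
    · simp [h1]
  T_top_T r x := by
    by_cases h : x = r
    · simp [h]
    · simp only [h, if_false]
      split_ifs with h2 <;> simp [h2]
  T_bot_T r x := by
    by_cases h : x = r
    · simp only [h, if_true]
      split_ifs with h2 <;> simp [h2]
    · simp [h]
  T_mid_T r s x h1 h2 := by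
    by_cases h : x = r
    · simp [h, Ne.symm h2]
    · simp [h, Ne.symm h1]
  T_top_le x := by by_cases h : x = ⊤ <;> simp [h]
  T_top_inf x y := by
    by_cases h1 : x = ⊤ <;> by_cases h2 : y = ⊤ <;> simp [h1, h2]
  T_ext x y := by
    refine le_trans (Finset.inf_le (Finset.mem_univ x)) ?_
    by_cases h : y = x
    · subst h; simp
    · simp [h]

/-- Subalgebras of the `L`-VL-algebra `L`. -/
@[ext]
structure Subalg where
  carrier : Set L
  sup_mem : ∀ {a b}, a ∈ carrier → b ∈ carrier → a ⊔ b ∈ carrier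
  inf_mem : ∀ {a b}, a ∈ carrier → b ∈ carrier → a ⊓ b ∈ carrier
  himp_mem : ∀ {a b}, a ∈ carrier → b ∈ carrier → a ⇨ b ∈ carrier
  T_mem : ∀ (r : L) {a}, a ∈ carrier → T r a ∈ carrier
  bot_mem : ⊥ ∈ carrier
  top_mem : ⊤ ∈ carrier

/-- The subalgebra `L` of `L`. -/
instance : Top (Subalg L) where
  top :=
    { carrier := Set.univ
      sup_mem := fun _ _ => trivial
      inf_mem := fun _ _ => trivial
      himp_mem := fun _ _ => trivial
      T_mem := fun _ _ _ => trivial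
      bot_mem := trivial
      top_mem := trivial }

/-- The intersection of two subalgebras. -/
instance : Min (Subalg L) where
  min M N :=
    { carrier := M.carrier ∩ N.carrier
      sup_mem := fun h k => ⟨M.sup_mem h.1 k.1, N.sup_mem h.2 k.2⟩
      inf_mem := fun h k => ⟨M.inf_mem h.1 k.1, N.inf_mem h.2 k.2⟩
      himp_mem := fun h k => ⟨M.himp_mem h.1 k.1, N.himp_mem h.2 k.2⟩
      T_mem := fun r _ h => ⟨M.T_mem r h.1, N.T_mem r h.2⟩
      bot_mem := ⟨M.bot_mem, N.bot_mem⟩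
      top_mem := ⟨M.top_mem, N.top_mem⟩ }

end TruthValues

section Spaces

open VLAlgebra

variable (L : Type u) [HeytingAlgebra L] [Fintype L]

/-- `L`-Boolean spaces: a compact Hausdorff zero-dimensional space with a closed subspace `sub M`
for each subalgebra `M` of `L`, such that `sub L` is the whole space and `sub` preserves binary
intersections. -/
structure BoolSpace where
  carrier : Type u
  [top : TopologicalSpace carrier]
  [compact : CompactSpace carrier]
  [t2 : T2Space carrier]
  zeroDim : TopologicalSpace.IsTopologicalBasis {s : Set carrier | IsClopen s}
  sub : Subalg L → Set carrier
  isClosed_sub : ∀ M, IsClosed (sub M)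
  sub_top : sub ⊤ = Set.univ
  sub_inf : ∀ M N, sub (M ⊓ N) = sub M ∩ sub N

attribute [instance] BoolSpace.top BoolSpace.compact BoolSpace.t2

variable {L}

/-- The set of subspace-preserving continuous functions `S → L`, where `L` is discrete and is
equipped with the subspace `M` for every subalgebra `M`.  (A function to a discrete space is
continuous iff all preimages of subsets are open, which is `IsLocallyConstant`.) -/
@[ext]
structure Cont (S : BoolSpace L) where
  toFun : S.carrier → L
  continuous' : IsLocallyConstant toFun
  map_sub : ∀ (M : Subalg L) (s : S.carrier), s ∈ S.sub M → toFun s ∈ M.carrier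

namespace Cont

variable {S : BoolSpace L}

theorem toFun_injective : Function.Injective (Cont.toFun : Cont S → S.carrier → L) :=
  fun _ _ h => Cont.ext h

/-! The operations on `Cont S` are pointwise. -/

instance : LE (Cont S) := ⟨fun f g => f.toFun ≤ g.toFun⟩

instance : LT (Cont S) := ⟨fun f g => f.toFun < g.toFun⟩

instance : Max (Cont S) :=
  ⟨fun f g =>
    { toFun := f.toFun ⊔ g.toFun
      continuous' := f.continuous'.comp₂ g.continuous' (· ⊔ ·)
      map_sub := fun M s h => M.sup_mem (f.map_sub M s h) (g.map_sub M s h) }⟩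

instance : Min (Cont S) :=
  ⟨fun f g =>
    { toFun := f.toFun ⊓ g.toFun
      continuous' := f.continuous'.comp₂ g.continuous' (· ⊓ ·)
      map_sub := fun M s h => M.inf_mem (f.map_sub M s h) (g.map_sub M s h) }⟩

instance : HImp (Cont S) :=
  ⟨fun f g =>
    { toFun := f.toFun ⇨ g.toFun
      continuous' := f.continuous'.comp₂ g.continuous' (· ⇨ ·)
      map_sub := fun M s h => M.himp_mem (f.map_sub M s h) (g.map_sub M s h) }⟩

instance : Top (Cont S) :=
  ⟨{ toFun := ⊤
     continuous' := IsLocallyConstant.const ⊤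
     map_sub := fun M _ _ => M.top_mem }⟩

instance : Bot (Cont S) :=
  ⟨{ toFun := ⊥
     continuous' := IsLocallyConstant.const ⊥
     map_sub := fun M _ _ => M.bot_mem }⟩

instance : Compl (Cont S) := ⟨fun f => f ⇨ ⊥⟩

instance : HeytingAlgebra (Cont S) :=
  toFun_injective.heytingAlgebra Cont.toFun Iff.rfl Iff.rfl (fun _ _ => rfl) (fun _ _ => rfl)
    rfl rfl (fun f => himp_bot f.toFun) (fun _ _ => rfl)

theorem sup_apply {ι : Type v} (t : Finset ι) (f : ι → Cont S) (s : S.carrier) :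
    (t.sup f).toFun s = t.sup fun i => (f i).toFun s :=
  Finset.apply_sup_eq_sup_comp (fun g : Cont S => g.toFun s) (fun _ _ => rfl) rfl

theorem inf_apply {ι : Type v} (t : Finset ι) (f : ι → Cont S) (s : S.carrier) :
    (t.inf f).toFun s = t.inf fun i => (f i).toFun s :=
  Finset.apply_inf_eq_inf_comp (fun g : Cont S => g.toFun s) (fun _ _ => rfl) rfl

/-- `T r` on `Cont S`, pointwise. -/
noncomputable def Tc (r : L) (f : Cont S) : Cont S where
  toFun s := T r (f.toFun s)
  continuous' := f.continuous'.comp (T r)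
  map_sub M s h := M.T_mem r (f.map_sub M s h)

noncomputable instance : VLAlgebra L (Cont S) where
  T := Tc
  T_ops r s f g := fun p => T_ops r s (f.toFun p) (g.toFun p)
  T_T_of_eq r s f h := fun p => T_T_of_eq r s (f.toFun p) h
  T_T_of_ne r s f h := fun p => T_T_of_ne r s (f.toFun p) h
  T_bot_bot := Cont.ext (funext fun _ => T_bot_bot)
  T_bot_of_ne r h := Cont.ext (funext fun _ => T_bot_of_ne r h)
  T_top_top := Cont.ext (funext fun _ => T_top_top)
  T_top_of_ne r h := Cont.ext (funext fun _ => T_top_of_ne r h)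
  sup_T f := Cont.ext (funext fun p => (sup_apply _ _ p).trans (sup_T (f.toFun p)))
  T_em r f := Cont.ext (funext fun p => T_em r (f.toFun p))
  T_inf_of_ne r s f h := Cont.ext (funext fun p => T_inf_of_ne r s (f.toFun p) h)
  T_top_T r f := Cont.ext (funext fun p => T_top_T r (f.toFun p))
  T_bot_T r f := Cont.ext (funext fun p => T_bot_T r (f.toFun p))
  T_mid_T r s f h k := Cont.ext (funext fun p => T_mid_T r s (f.toFun p) h k)
  T_top_le f := fun p => T_top_le (L := L) (f.toFun p)
  T_top_inf f g := Cont.ext (funext fun p => T_top_inf (L := L) (f.toFun p) (g.toFun p))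
  T_ext f g := fun p => (inf_apply _ _ p).trans_le (T_ext (L := L) (f.toFun p) (g.toFun p))

end Cont

open scoped Classical in
/-- `(□_R f)(x)` is the meet of all `f y` with `x R y` (a meet in the finite lattice `L`). -/
noncomputable def boxFun {X : Type v} (R : X → X → Prop) (f : X → L) (x : X) : L :=
  (Finset.univ.filter fun r : L => ∃ y, R x y ∧ f y = r).inf id

theorem le_boxFun {X : Type v} (R : X → X → Prop) (f : X → L) (x : X) (r : L) :
    r ≤ boxFun R f x ↔ ∀ y, R x y → r ≤ f y := by
  simp [boxFun]

variable (L)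

/-- `L`-relational spaces: an `L`-Boolean space with a binary relation satisfying Maruyama's
three conditions. -/
structure RelSpace extends BoolSpace L where
  rel : carrier → carrier → Prop
  rel_of_box : ∀ x y : carrier,
    (∀ f : Cont toBoolSpace, boxFun rel f.toFun x = ⊤ → f.toFun y = ⊤) → rel x y
  isClopen_preimage : ∀ X : Set carrier, IsClopen X → IsClopen {s | ∃ t ∈ X, rel s t}
  rel_sub : ∀ (M : Subalg L) (x y : carrier), x ∈ sub M → rel x y → y ∈ sub M

/-- Morphisms of `L`-relational spaces: continuous maps that preserve the distinguished subspaces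
and are bounded morphisms for the relations. -/
@[ext]
structure RelSpaceHom (S S' : RelSpace L) where
  toFun : S.carrier → S'.carrier
  continuous' : Continuous toFun
  map_sub : ∀ (M : Subalg L) (s : S.carrier), s ∈ S.sub M → toFun s ∈ S'.sub M
  map_rel : ∀ s t : S.carrier, S.rel s t → S'.rel (toFun s) (toFun t)
  lift_rel : ∀ (s : S.carrier) (s' : S'.carrier), S'.rel (toFun s) s' →
    ∃ t, S.rel s t ∧ toFun t = s'

instance : Category (RelSpace L) where
  Hom S S' := RelSpaceHom L S S'
  id S :=
    { toFun := fun s => s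
      continuous' := continuous_id
      map_sub := fun _ _ h => h
      map_rel := fun _ _ h => h
      lift_rel := fun _ s' h => ⟨s', h, rfl⟩ }
  comp f g :=
    { toFun := fun s => g.toFun (f.toFun s)
      continuous' := g.continuous'.comp f.continuous'
      map_sub := fun M s h => g.map_sub M _ (f.map_sub M s h)
      map_rel := fun s t h => g.map_rel _ _ (f.map_rel s t h)
      lift_rel := fun s s' h => by
        obtain ⟨t', h1, h2⟩ := g.lift_rel _ _ h
        obtain ⟨t, h3, h4⟩ := f.lift_rel _ _ h1
        exact ⟨t, h3, by rw [h4, h2]⟩ }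

end Spaces

section Cont

open VLAlgebra

variable {L : Type u} [HeytingAlgebra L] [Fintype L]

theorem Subalg.finset_inf_mem (M : Subalg L) (t : Finset L) (h : ∀ r ∈ t, r ∈ M.carrier) :
    t.inf id ∈ M.carrier := by
  classical
  induction t using Finset.induction_on with
  | empty => exact M.top_mem
  | insert a t _ ih =>
    rw [Finset.inf_insert]
    exact M.inf_mem (h a (Finset.mem_insert_self a t))
      (ih fun r hr => h r (Finset.mem_insert_of_mem hr))

theorem isLocallyConstant_of_le {X : Type v} [TopologicalSpace X] (g : X → L)
    (h : ∀ r : L, IsClopen {x | r ≤ g x}) : IsLocallyConstant g := by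
  rw [IsLocallyConstant.iff_isOpen_fiber]
  intro r
  have : g ⁻¹' {r} = ⋂ s : L, {x | s ≤ g x ↔ s ≤ r} := by
    ext x
    simp only [Set.mem_preimage, Set.mem_singleton_iff, Set.mem_iInter, Set.mem_ofPred_eq]
    exact ⟨fun e s => by rw [e], fun e => eq_of_forall_le_iff e⟩
  rw [this]
  refine isOpen_iInter_of_finite fun s => ?_
  by_cases hs : s ≤ r
  · simpa [hs] using (h s).isOpen
  · simpa [hs, Set.compl_ofPred] using (h s).compl.isOpen

open scoped Classical in
/-- The operation `□_R` on `Cont S`. -/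
noncomputable def Cont.box (S : RelSpace L) (f : Cont S.toBoolSpace) : Cont S.toBoolSpace where
  toFun := boxFun S.rel f.toFun
  continuous' := by
    refine isLocallyConstant_of_le _ fun r => ?_
    have h : {x | r ≤ boxFun S.rel f.toFun x}
        = {s | ∃ t ∈ {t | ¬ r ≤ f.toFun t}, S.rel s t}ᶜ := by
      ext x
      simp only [Set.mem_ofPred_eq, le_boxFun, Set.mem_compl_iff, not_exists, not_and]
      exact ⟨fun H y hy hr => hy (H y hr), fun H y hr => not_not.1 fun hy => H y hy hr⟩
    rw [h]
    exact (S.isClopen_preimage _ ⟨⟨by simpa [Set.compl_ofPred] using f.continuous' {t | r ≤ t}⟩, f.continuous' {t | ¬ r ≤ t}⟩).compl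
  map_sub M s h := by
    refine M.finset_inf_mem _ fun r hr => ?_
    obtain ⟨y, hy, rfl⟩ := (Finset.mem_filter.1 hr).2
    exact f.map_sub M y (S.rel_sub M s y h hy)

theorem U_eq_ite (r a : L) [Decidable (r ≤ a)] : U r a = if r ≤ a then (⊤ : L) else ⊥ := by
  classical
  unfold U
  split_ifs with h
  · refine top_le_iff.1 ?_
    have := Finset.le_sup (f := fun s : L => (T s a : L))
      (Finset.mem_filter.2 ⟨Finset.mem_univ a, h⟩)
    simpa [T] using this
  · refine le_bot_iff.1 (Finset.sup_le fun s hs => ?_)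
    have hs : r ≤ s := (Finset.mem_filter.1 hs).2
    have : a ≠ s := fun e => h (e ▸ hs)
    simp [T, this]

theorem Cont.U_apply {S : BoolSpace L} (r : L) (f : Cont S) (s : S.carrier) :
    (U r f).toFun s = U r (f.toFun s) :=
  Cont.sup_apply _ _ s

/-- `(Cont S, □_R)` is an `L`-ML-algebra. -/
noncomputable instance Cont.mlAlgebra (S : RelSpace L) : MLAlgebra L (Cont S.toBoolSpace) where
  box := Cont.box S
  box_inf f g := Cont.ext (funext fun x => eq_of_forall_le_iff fun c => by
    change c ≤ boxFun S.rel _ x ↔ c ≤ boxFun S.rel _ x ⊓ boxFun S.rel _ x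
    rw [le_inf_iff, le_boxFun, le_boxFun, le_boxFun]
    exact ⟨fun h => ⟨fun y hy => (h y hy).trans inf_le_left,
      fun y hy => (h y hy).trans inf_le_right⟩, fun h y hy => le_inf (h.1 y hy) (h.2 y hy)⟩)
  box_top := Cont.ext (funext fun x => top_le_iff.1 ((le_boxFun _ _ _ _).2 fun _ _ => le_rfl))
  U_box r f := Cont.ext (funext fun x => by
    classical
    rw [Cont.U_apply]
    change U r (boxFun S.rel f.toFun x) = boxFun S.rel (U r f).toFun x
    refine eq_of_forall_le_iff fun c => ?_
    rw [le_boxFun, U_eq_ite]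
    simp only [Cont.U_apply, U_eq_ite]
    split_ifs with h
    · rw [le_boxFun] at h
      exact ⟨fun _ y hy => by rw [if_pos (h y hy)]; exact le_top, fun _ => le_top⟩
    · refine ⟨fun hc _ _ => hc.trans bot_le, fun hc => ?_⟩
      rw [le_boxFun] at h
      push Not at h
      obtain ⟨y, hy, hr⟩ := h
      simpa [hr] using hc y hy)

variable (L)

/-- The contravariant functor `S ↦ (Cont S, □_R)`, `f ↦ (v ↦ v ∘ f)` from `L`-relational spaces to
`L`-ML-algebras. -/
noncomputable def contFunctor : RelSpace L ⥤ (MLCat L)ᵒᵖ where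
  obj S := Opposite.op ⟨Cont S.toBoolSpace⟩
  map {S S'} f := Quiver.Hom.op (V := MLCat L) (X := ⟨Cont S'.toBoolSpace⟩)
    (Y := ⟨Cont S.toBoolSpace⟩)
    ({toFun := fun v =>
        { toFun := fun s => v.toFun (f.toFun s)
          continuous' := v.continuous'.comp_continuous f.continuous'
          map_sub := fun M s h => v.map_sub M _ (f.map_sub M s h) }
      map_sup := fun _ _ => rfl
      map_inf := fun _ _ => rfl
      map_himp := fun _ _ => rfl
      map_T := fun _ _ => rfl
      map_bot := rfl
      map_top := rfl
      map_box := fun v => Cont.ext (funext fun s => eq_of_forall_le_iff fun c => by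
        change c ≤ boxFun S'.rel v.toFun (f.toFun s) ↔
          c ≤ boxFun S.rel (fun s => v.toFun (f.toFun s)) s
        rw [le_boxFun, le_boxFun]
        refine ⟨fun h t ht => h _ (f.map_rel _ _ ht), fun h t' ht' => ?_⟩
        obtain ⟨t, ht, rfl⟩ := f.lift_rel _ _ ht'
        exact h t ht) } : MLHom L (Cont S'.toBoolSpace) (Cont S.toBoolSpace))

end Cont

section Spec

variable (L : Type u) [HeytingAlgebra L] [Fintype L]

/-- The spectrum of `A`: all homomorphisms of `L`-VL-algebras `A → L`. -/
abbrev Spec (A : Type v) [HeytingAlgebra A] [VLAlgebra L A] : Type (max u v) := VLHom L A L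

/-- The topology on the spectrum generated by the sets `{v | v a = 1}`, `a ∈ A`. -/
instance (A : Type v) [HeytingAlgebra A] [VLAlgebra L A] : TopologicalSpace (Spec L A) :=
  TopologicalSpace.generateFrom {X | ∃ a : A, X = {v | v.toFun a = ⊤}}

variable {L}

/-- The spectrum relative to a subalgebra `M` of `L`: the homomorphisms with values in `M`. -/
def specSub (A : Type v) [HeytingAlgebra A] [VLAlgebra L A] (M : Subalg L) : Set (Spec L A) :=
  {v | ∀ a, v.toFun a ∈ M.carrier}

/-- The canonical relation on the spectrum of an `L`-ML-algebra. -/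
def specRel {A : Type v} [HeytingAlgebra A] [MLAlgebra L A] (v w : Spec L A) : Prop :=
  ∀ (r : L) (a : A), r ≤ v.toFun (MLAlgebra.box L a) → r ≤ w.toFun a

end Spec

end FittingDuality

open FittingDuality

namespace FittingDuality

open VLAlgebra

/-! ### Truth-value operations and homomorphisms -/

section Hom

variable {L : Type u} [HeytingAlgebra L] [Fintype L]

/-! The algebra `L` plays the role of the two-element algebra in Stone duality. For fixed `a` the
elements `T r a` are pairwise disjoint with join 1, so a prime ideal misses exactly one of them;
sending `a` to that `r` is a homomorphism to `L` (`exists_spec_of_isPrime`). The prime ideal theorem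
thus supplies enough points, in the form of `exists_spec_separating`. Three choices of the set to be
made true there give that points separate elements (`spec_ext`), that `□ a` is computed by the
canonical relation (`le_apply_box_iff`), and that duals of modal homomorphisms have the lifting
property (`exists_specRel_lift`). The axiom `U_box` reduces every threshold `r` to the value 1,
where `□` can be treated as in the classical case.

The rest is compactness. On the spectrum it glues local values, so that every function in `Cont` is
an evaluation (`evalHom_surjective`); on a space `S` it shows that every homomorphism `Cont S → L`
is evaluation at a point (`evalAt_surjective`). The distinguished subspaces are recovered because
clopen indicators realise every value that a point admits (`mem_sub_iff_evalAt`), and the relation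
is recovered by condition (1) on relational spaces (`rel_iff_specRel_evalAt`). -/

theorem T_eq_top_iff [Nontrivial L] {r s : L} : (T r s : L) = ⊤ ↔ s = r := by
  classical
  change (if s = r then (⊤ : L) else ⊥) = ⊤ ↔ _
  by_cases h : s = r <;> simp [h, bot_ne_top]

theorem U_eq_top_iff [Nontrivial L] {r s : L} : (U r s : L) = ⊤ ↔ r ≤ s := by
  classical
  rw [U_eq_ite]
  by_cases h : r ≤ s <;> simp [h, bot_ne_top]

variable {A : Type v} [HeytingAlgebra A]

theorem U_top [VLAlgebra L A] (a : A) : U (⊤ : L) a = T (⊤ : L) a := by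
  classical
  unfold U
  have : (Finset.univ.filter fun s : L => ⊤ ≤ s) = {⊤} := by ext s; simp
  rw [this, Finset.sup_singleton]

theorem VLHom.map_finset_sup [VLAlgebra L A] {B : Type w} [HeytingAlgebra B] [VLAlgebra L B]
    (f : VLHom L A B) {ι : Type x} (t : Finset ι) (g : ι → A) :
    f.toFun (t.sup g) = t.sup fun i => f.toFun (g i) :=
  Finset.apply_sup_eq_sup_comp f.toFun f.map_sup f.map_bot

theorem VLHom.map_U [VLAlgebra L A] {B : Type w} [HeytingAlgebra B] [VLAlgebra L B]
    (f : VLHom L A B) (r : L) (a : A) : f.toFun (U r a) = U r (f.toFun a) := by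
  unfold U
  rw [f.map_finset_sup]
  simp only [f.map_T]

theorem VLHom.monotone [VLAlgebra L A] {B : Type w} [HeytingAlgebra B] [VLAlgebra L B]
    (f : VLHom L A B) : Monotone f.toFun := fun a b h => by
  rw [← inf_eq_left, ← f.map_inf, inf_eq_left.2 h]

/-! ### Points of the spectrum from prime ideals -/

section Spectrum

variable [VLAlgebra L A]

theorem apply_T_eq_top_iff [Nontrivial L] (v : Spec L A) (r : L) (a : A) :
    v.toFun (T r a) = ⊤ ↔ v.toFun a = r := by
  rw [v.map_T, T_eq_top_iff]

theorem apply_U_eq_top_iff [Nontrivial L] (v : Spec L A) (r : L) (a : A) :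
    v.toFun (U r a) = ⊤ ↔ r ≤ v.toFun a := by
  rw [v.map_U, U_eq_top_iff]

/-- A complement of a prime filter `P` of `A` determines the homomorphism sending `a` to the unique
`r` with `T r a ∈ P`. -/
theorem exists_spec_of_isPrime (I : Order.Ideal A) (hI : I.IsPrime) :
    ∃ v : Spec L A, ∀ (r : L) (a : A), T r a ∉ I ↔ v.toFun a = r := by
  classical
  have htop : (⊤ : A) ∉ I := hI.toIsProper.top_notMem
  have hex : ∀ a : A, ∃ r : L, T r a ∉ I := fun a => by
    by_contra! h
    have hs : ∀ t : Finset L, (t.sup fun r : L => T r a) ∈ I := fun t =>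
      Finset.sup_induction I.bot_mem (fun _ hx _ hy => Order.Ideal.sup_mem hx hy) fun r _ => h r
    exact htop (sup_T (L := L) a ▸ hs Finset.univ)
  have hinf : ∀ {x y : A}, x ∉ I → y ∉ I → x ⊓ y ∉ I := fun hx hy h =>
    (hI.mem_or_mem h).elim hx hy
  have huniq : ∀ (a : A) (r s : L), T r a ∉ I → T s a ∉ I → r = s := fun a r s hr hs => by
    by_contra hne
    exact hinf hr hs (T_inf_of_ne r s a hne ▸ I.bot_mem)
  choose g hg using hex
  have key : ∀ (r : L) (a : A), T r a ∉ I ↔ g a = r := fun r a =>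
    ⟨fun h => huniq a _ _ (hg a) h, fun h => h ▸ hg a⟩
  have hup : ∀ {x y : A}, x ∉ I → x ≤ y → y ∉ I := fun hx hxy hy => hx (I.lower hxy hy)
  -- The single axiom `T_ops` settles `⇨`, `⊓` and `⊔` together: an element outside `I` lies below
  -- the meet of the three expected `T`'s, so each of them is outside `I`.
  have hops : ∀ a b : A, T (g a ⇨ g b) (a ⇨ b) ⊓ T (g a ⊓ g b) (a ⊓ b)
      ⊓ T (g a ⊔ g b) (a ⊔ b) ∉ I := fun a b =>
    hup (hinf (hg a) (hg b)) (T_ops (g a) (g b) a b)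
  refine ⟨⟨g, fun a b => ?_, fun a b => ?_, fun a b => ?_, fun r a => ?_, ?_, ?_⟩, key⟩
  · exact (key _ _).1 (hup (hops a b) inf_le_right)
  · exact (key _ _).1 (hup (hops a b) (inf_le_left.trans inf_le_right))
  · exact (key _ _).1 (hup (hops a b) (inf_le_left.trans inf_le_left))
  · refine (key _ _).1 ?_
    change T (if g a = r then (⊤ : L) else ⊥) _ ∉ I
    split_ifs with h
    · exact hup (hg a) (T_T_of_eq r _ a h)
    · exact hup (hg a) (T_T_of_ne r _ a h)
  · exact (key _ _).1 (by rw [T_bot_bot]; exact htop)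
  · exact (key _ _).1 (by rw [T_top_top]; exact htop)

/-- Separation of a set closed under finite meets from an element by a point of the spectrum. -/
theorem exists_spec_separating (F : Set A) (hne : F.Nonempty)
    (hinf : ∀ x ∈ F, ∀ y ∈ F, x ⊓ y ∈ F) (c : A) (hc : ∀ x ∈ F, ¬ T (⊤ : L) x ≤ c) :
    ∃ v : Spec L A, (∀ x ∈ F, v.toFun x = ⊤) ∧ v.toFun c ≠ ⊤ := by
  -- The filter is generated by the elements `T ⊤ x` rather than `x`: the value of a point at `x` is
  -- 1 exactly when `T ⊤ x`, not merely `x`, avoids the prime ideal. It is closed under meets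
  -- because `T ⊤` preserves them.
  have hP : Order.IsPFilter {y : A | ∃ x ∈ F, T (⊤ : L) x ≤ y} := by
    refine Order.IsPFilter.of_def ?_ ?_ ?_
    · obtain ⟨x, hx⟩ := hne
      exact ⟨_, x, hx, le_rfl⟩
    · rintro y ⟨a, ha, hay⟩ z ⟨b, hb, hbz⟩
      refine ⟨T ⊤ (a ⊓ b), ⟨_, hinf a ha b hb, le_rfl⟩, ?_, ?_⟩ <;> rw [T_top_inf]
      · exact inf_le_left.trans hay
      · exact inf_le_right.trans hbz
    · rintro x y hxy ⟨a, ha, hax⟩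
      exact ⟨a, ha, hax.trans hxy⟩
  obtain ⟨J, hJ, hcJ, hdis⟩ := DistribLattice.prime_ideal_of_disjoint_filter_ideal
    (F := hP.toPFilter) (I := Order.Ideal.principal c) (by
      rw [Set.disjoint_left]
      rintro y ⟨x, hx, hxy⟩ hyc
      exact hc x hx (hxy.trans hyc))
  obtain ⟨v, hv⟩ := exists_spec_of_isPrime (L := L) J hJ
  refine ⟨v, fun x hx => (hv ⊤ x).1 fun hJx => ?_, fun h => (hv ⊤ c).2 h ?_⟩
  · exact Set.disjoint_left.1 hdis (show _ ∈ {y : A | ∃ x ∈ F, T (⊤ : L) x ≤ y} from ⟨x, hx, le_rfl⟩) hJx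
  · exact J.lower (T_top_le c) (Order.Ideal.principal_le_iff.1 hcJ)

/-- The points of the spectrum separate the elements of `A`. -/
theorem spec_ext [Nontrivial L] {a b : A} (h : ∀ v : Spec L A, v.toFun a = v.toFun b) :
    a = b := by
  -- By `T_ext` it suffices to compare the `T r`. The elements are quantified afresh so that the
  -- inequality can be used in both directions.
  have hT : ∀ {a b : A}, (∀ v : Spec L A, v.toFun a = v.toFun b) →
      ∀ r : L, T r a ≤ T r b := fun {a b} h r => by
    by_contra hr
    obtain ⟨v, hv, hvc⟩ := exists_spec_separating (L := L) {T r a} ⟨_, rfl⟩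
      (by rintro _ rfl _ rfl; exact inf_idem _) (T r b)
      (by rintro _ rfl; rwa [T_top_T])
    have := hv _ rfl
    rw [apply_T_eq_top_iff] at this
    exact hvc ((apply_T_eq_top_iff v r b).2 (h v ▸ this))
  have htop : (⊤ : A) ≤ (a ⇨ b) ⊓ (b ⇨ a) := by
    refine le_trans (Finset.le_inf fun r _ => ?_) (T_ext (L := L) a b)
    exact le_inf (top_le_iff.2 (himp_eq_top_iff.2 (hT h r)))
      (top_le_iff.2 (himp_eq_top_iff.2 (hT (fun v => (h v).symm) r)))
  rw [top_le_iff, inf_eq_top_iff, himp_eq_top_iff, himp_eq_top_iff] at htop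
  exact le_antisymm htop.1 htop.2

end Spectrum

/-! ### The modality and the canonical relation -/

section Modal

open MLAlgebra

variable [MLAlgebra L A]

theorem box_mono {a b : A} (h : a ≤ b) : box L a ≤ box L b := by
  rw [← inf_eq_left, ← box_inf, inf_eq_left.2 h]

variable [Nontrivial L]

theorem apply_box_U_eq_top_iff (v : Spec L A) (r : L) (a : A) :
    v.toFun (box L (U r a)) = ⊤ ↔ r ≤ v.toFun (box L a) := by
  rw [← U_box, apply_U_eq_top_iff]

/-- `T ⊤` is `U ⊤`, which commutes with `□`. This supplies the `T ⊤` demanded by the hypothesis of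
`exists_spec_separating`. -/
theorem apply_box_T_top {v : Spec L A} {a : A} (h : v.toFun (box L a) = ⊤) :
    v.toFun (box L (T (⊤ : L) a)) = ⊤ := by
  rw [← U_top, apply_box_U_eq_top_iff, h]

/-- Applying the condition at value 1 to `U r a` recovers the condition at threshold `r`, since `U
r` commutes with `□`. -/
theorem specRel_iff {v w : Spec L A} :
    specRel v w ↔ ∀ a, v.toFun (box L a) = ⊤ → w.toFun a = ⊤ :=
  ⟨fun h a ha => top_le_iff.1 (h ⊤ a ha.ge), fun h r a hr =>
    (apply_U_eq_top_iff w r a).1 (h _ ((apply_box_U_eq_top_iff v r a).2 hr))⟩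

/-- The value of `□ a` at `v` is the meet of the values of `a` at the successors of `v`. -/
theorem le_apply_box_iff (v : Spec L A) (r : L) (a : A) :
    r ≤ v.toFun (box L a) ↔ ∀ w : Spec L A, specRel v w → r ≤ w.toFun a := by
  refine ⟨fun h w hw => hw r a h, fun h => ?_⟩
  by_contra hr
  rw [← apply_box_U_eq_top_iff] at hr
  -- Making this set true is, by `specRel_iff`, the same as being a successor of `v`.
  obtain ⟨w, hw, hwa⟩ := exists_spec_separating (L := L) {x : A | v.toFun (box L x) = ⊤}
    ⟨⊤, by rw [Set.mem_ofPred_eq, box_top, v.map_top]⟩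
    (fun x (hx : _ = _) y (hy : _ = _) => by
      rw [Set.mem_ofPred_eq, box_inf, v.map_inf, hx, hy, inf_idem]) (U r a)
    (fun x hx hle => hr (top_le_iff.1
      ((apply_box_T_top hx).ge.trans (v.monotone (box_mono hle)))))
  exact hwa ((apply_U_eq_top_iff w r a).2 (h w (specRel_iff.2 hw)))

/-- Precomposition with a homomorphism of `L`-ML-algebras is a bounded morphism of spectra. -/
theorem exists_specRel_lift {B : Type w} [HeytingAlgebra B] [MLAlgebra L B] (φ : MLHom L A B)
    (v : Spec L B) (w : Spec L A) (h : specRel (v.comp φ.toVLHom) w) :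
    ∃ w' : Spec L B, specRel v w' ∧ w'.comp φ.toVLHom = w := by
  obtain ⟨w', hw', -⟩ := exists_spec_separating (L := L)
    -- The factors `y` force `w'` to be a successor of `v`; the factors `φ a` force its restriction
    -- along `φ` to agree with `w`.
    {z : B | ∃ y a, v.toFun (box L y) = ⊤ ∧ w.toFun a = ⊤ ∧ z = y ⊓ φ.toFun a}
    ⟨⊤, ⊤, ⊤, by rw [box_top, v.map_top], w.map_top, by rw [φ.map_top, inf_idem]⟩
    (by
      rintro _ ⟨y, a, hy, ha, rfl⟩ _ ⟨y', a', hy', ha', rfl⟩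
      refine ⟨y ⊓ y', a ⊓ a', ?_, ?_, ?_⟩
      · rw [box_inf, v.map_inf, hy, hy', inf_idem]
      · rw [w.map_inf, ha, ha', inf_idem]
      · rw [φ.map_inf, inf_inf_inf_comm])
    ⊥
    (by
      rintro _ ⟨y, a, hy, ha, rfl⟩ hle
      -- If the meet vanished, `T ⊤ y` would lie below `φ (T ⊤ a ⇨ ⊥)`. Applying `□` and `v`, then
      -- the relation `h`, would make `T ⊤ a ⇨ ⊥` true at `w`, although `w a = 1`.
      rw [T_top_inf, ← φ.map_T, ← le_himp_iff, ← φ.map_bot, ← φ.map_himp] at hle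
      have h1 := (apply_box_T_top hy).ge.trans (v.monotone (box_mono hle))
      rw [← φ.map_box, top_le_iff] at h1
      have h2 := specRel_iff.1 h _ h1
      rw [w.map_himp, (apply_T_eq_top_iff w ⊤ a).2 ha, w.map_bot, top_himp] at h2
      exact bot_ne_top h2)
  refine ⟨w', specRel_iff.2 fun y hy => hw' y
    ⟨y, ⊤, hy, w.map_top, by rw [φ.map_top, inf_top_eq]⟩, VLHom.ext (funext fun a => ?_)⟩
  -- The set controls only value 1; applying it to `T (w a) a`, which is true at `w`, pins down the
  -- exact value.
  refine (apply_T_eq_top_iff w' _ _).1 ?_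
  rw [← φ.map_T]
  exact hw' _ ⟨⊤, T (w.toFun a) a, by rw [box_top, v.map_top], (apply_T_eq_top_iff w _ a).2 rfl,
    by rw [top_inf_eq]⟩

end Modal

end Hom

/-! ### The spectrum as a zero-dimensional compact Hausdorff space -/

section SpecTopology

variable {L : Type u} [HeytingAlgebra L] [Fintype L] [Nontrivial L]
variable {A : Type v} [HeytingAlgebra A] [VLAlgebra L A]

omit [Nontrivial L] in
theorem isOpen_apply_eq_top (a : A) : IsOpen {v : Spec L A | v.toFun a = ⊤} :=
  TopologicalSpace.isOpen_generateFrom_of_mem ⟨a, rfl⟩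

/-- The fibre over `r` is itself a generating open set, namely the one given by `T r a`. -/
theorem isLocallyConstant_apply (a : A) :
    IsLocallyConstant fun v : Spec L A => v.toFun a := by
  rw [IsLocallyConstant.iff_isOpen_fiber]
  intro r
  have : (fun v : Spec L A => v.toFun a) ⁻¹' {r} = {v | v.toFun (T r a) = ⊤} := by
    ext v
    exact (apply_T_eq_top_iff v r a).symm
  rw [this]
  exact isOpen_apply_eq_top _

theorem isClopen_apply_mem (a : A) (X : Set L) : IsClopen {v : Spec L A | v.toFun a ∈ X} :=
  ⟨⟨isLocallyConstant_apply a Xᶜ⟩, isLocallyConstant_apply a X⟩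

omit [Nontrivial L] in
theorem isTopologicalBasis_spec :
    TopologicalSpace.IsTopologicalBasis {X : Set (Spec L A) | ∃ a : A, X = {v | v.toFun a = ⊤}} := by
  have h := TopologicalSpace.isTopologicalBasis_of_subbasis_of_inter
    (r := {X : Set (Spec L A) | ∃ a : A, X = {v | v.toFun a = ⊤}}) rfl (by
      rintro _ ⟨a, rfl⟩ _ ⟨b, rfl⟩
      refine ⟨a ⊓ b, ?_⟩
      ext v
      simp [v.map_inf])
  rwa [Set.insert_eq_of_mem] at h
  exact ⟨⊤, by ext v; simp [v.map_top]⟩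

instance : T2Space (Spec L A) := by
  refine ⟨fun v w hvw => ?_⟩
  obtain ⟨a, ha⟩ : ∃ a, v.toFun a ≠ w.toFun a := by
    by_contra! h
    exact hvw (VLHom.ext (funext h))
  refine ⟨_, _, isLocallyConstant_apply a {v.toFun a}, isLocallyConstant_apply a {w.toFun a},
    rfl, rfl, ?_⟩
  rw [Set.disjoint_left]
  intro x hx hy
  exact ha (Eq.trans (Eq.symm hx) hy)

omit [Nontrivial L] in
/-- The limit of an ultrafilter on the spectrum is computed pointwise. -/
theorem exists_ultrafilter_limit (𝒰 : Ultrafilter (Spec L A)) :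
    ∃ v : Spec L A, ∀ a, ∀ᶠ w : Spec L A in 𝒰, w.toFun a = v.toFun a := by
  have hex : ∀ a : A, ∃ r : L, ∀ᶠ w : Spec L A in 𝒰, w.toFun a = r := fun a => by
    -- The fibres of evaluation at `a` form a finite cover because `L` is finite, so the ultrafilter
    -- contains one of them.
    have h : (⋃ r ∈ (Set.univ : Set L), {w : Spec L A | w.toFun a = r}) ∈ 𝒰 := by
      convert! (Filter.univ_mem : Set.univ ∈ (𝒰 : Filter (Spec L A)))
      ext w
      simp
    obtain ⟨r, -, hr⟩ := (Ultrafilter.finite_biUnion_mem_iff Set.finite_univ).1 h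
    exact ⟨r, hr⟩
  choose g hg using hex
  have huniq : ∀ {a : A} {r : L}, (∀ᶠ w : Spec L A in 𝒰, w.toFun a = r) → g a = r :=
    fun {a r} h => by
      obtain ⟨w, h1, h2⟩ := ((hg a).and h).exists
      exact h1.symm.trans h2
  refine ⟨⟨g, fun a b => huniq ?_, fun a b => huniq ?_, fun a b => huniq ?_, fun r a => huniq ?_,
    huniq ?_, huniq ?_⟩, hg⟩
  · filter_upwards [hg a, hg b] with w ha hb
    rw [w.map_sup, ha, hb]
  · filter_upwards [hg a, hg b] with w ha hb
    rw [w.map_inf, ha, hb]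
  · filter_upwards [hg a, hg b] with w ha hb
    rw [w.map_himp, ha, hb]
  · filter_upwards [hg a] with w ha
    rw [w.map_T, ha]
  · exact Filter.Eventually.of_forall fun w => w.map_bot
  · exact Filter.Eventually.of_forall fun w => w.map_top

instance : CompactSpace (Spec L A) := by
  refine ⟨isCompact_iff_ultrafilter_le_nhds.2 fun 𝒰 _ => ?_⟩
  obtain ⟨v, hv⟩ := exists_ultrafilter_limit 𝒰
  refine ⟨v, trivial, ?_⟩
  rw [TopologicalSpace.nhds_generateFrom]
  refine le_iInf₂ fun X hX => ?_
  obtain ⟨hvX, a, rfl⟩ := hX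
  rw [Filter.le_principal_iff]
  filter_upwards [hv a] with w hw
  exact hw.trans hvX

theorem isTopologicalBasis_isClopen_spec :
    TopologicalSpace.IsTopologicalBasis {X : Set (Spec L A) | IsClopen X} := by
  refine TopologicalSpace.isTopologicalBasis_of_isOpen_of_nhds (fun X hX => hX.isOpen)
    fun v X hv hX => ?_
  obtain ⟨_, ⟨a, rfl⟩, hva, ha⟩ := isTopologicalBasis_spec.exists_subset_of_mem_open hv hX
  exact ⟨_, isClopen_apply_mem a {⊤}, hva, ha⟩

theorem isClosed_specSub (M : Subalg L) : IsClosed (specSub A M) := by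
  have : specSub A M = ⋂ a : A, {v : Spec L A | v.toFun a ∈ M.carrier} := by
    ext v
    simp [specSub]
  rw [this]
  exact isClosed_iInter fun a => (isClopen_apply_mem a _).isClosed

end SpecTopology

/-- If `v R w` and `w a = r`, then `□ (T r a ⇨ a)` has the value `r` at `v`. -/
theorem specRel_mem_specSub {L : Type u} [HeytingAlgebra L] [Fintype L] [Nontrivial L]
    {A : Type v} [HeytingAlgebra A] [MLAlgebra L A] {M : Subalg L} {v w : Spec L A}
    (hv : v ∈ specSub A M) (hvw : specRel v w) : w ∈ specSub A M := by
  intro a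
  -- With `r = w a`, the element `T r a ⇨ a` has value `r` wherever `a` does and value 1 elsewhere.
  -- Its least value over the successors of `v`, among them `w`, is therefore `r`, which is then a
  -- value of `v`.
  have hbox : v.toFun (MLAlgebra.box L (T (w.toFun a) a ⇨ a)) = w.toFun a := by
    refine le_antisymm ?_ ((le_apply_box_iff v _ _).2 fun w' _ => ?_)
    · have h := hvw _ (T (w.toFun a) a ⇨ a) le_rfl
      rwa [w.map_himp, (apply_T_eq_top_iff w _ a).2 rfl, top_himp] at h
    · rw [w'.map_himp, w'.map_T, le_himp_iff]
      by_cases h : w'.toFun a = w.toFun a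
      · exact inf_le_left.trans h.ge
      · exact inf_le_right.trans ((if_neg h).trans_le bot_le)
  exact hbox ▸ hv _

/-! ### Elements as functions on the spectrum -/

section SpecSpace

variable (L : Type u) [HeytingAlgebra L] [Fintype L] [Nontrivial L]

/-- The spectrum as an `L`-Boolean space. -/
def specBoolSpace (A : Type u) [HeytingAlgebra A] [VLAlgebra L A] : BoolSpace L where
  carrier := Spec L A
  zeroDim := isTopologicalBasis_isClopen_spec
  sub := specSub A
  isClosed_sub := isClosed_specSub
  sub_top := Set.eq_univ_of_forall fun _ _ => trivial
  sub_inf _ _ := Set.ext fun _ => forall_and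

variable {L}

/-- The range of a homomorphism into `L`. -/
def specRange {A : Type v} [HeytingAlgebra A] [VLAlgebra L A] (v : Spec L A) : Subalg L where
  carrier := Set.range v.toFun
  sup_mem := by
    rintro _ _ ⟨a, rfl⟩ ⟨b, rfl⟩
    exact ⟨_, v.map_sup a b⟩
  inf_mem := by
    rintro _ _ ⟨a, rfl⟩ ⟨b, rfl⟩
    exact ⟨_, v.map_inf a b⟩
  himp_mem := by
    rintro _ _ ⟨a, rfl⟩ ⟨b, rfl⟩
    exact ⟨_, v.map_himp a b⟩
  T_mem := by
    rintro r _ ⟨a, rfl⟩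
    exact ⟨_, v.map_T r a⟩
  bot_mem := ⟨_, v.map_bot⟩
  top_mem := ⟨_, v.map_top⟩

variable {A : Type u} [HeytingAlgebra A] [VLAlgebra L A]

/-- The evaluation of the elements of `A` at the points of the spectrum. -/
def evalHom (A : Type u) [HeytingAlgebra A] [VLAlgebra L A] :
    VLHom L A (Cont (specBoolSpace L A)) where
  toFun a :=
    { toFun := fun v : Spec L A => v.toFun a
      continuous' := isLocallyConstant_apply a
      map_sub := fun _ _ h => h a }
  map_sup a b := Cont.ext (funext fun v : Spec L A => v.map_sup a b)
  map_inf a b := Cont.ext (funext fun v : Spec L A => v.map_inf a b)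
  map_himp a b := Cont.ext (funext fun v : Spec L A => v.map_himp a b)
  map_T r a := Cont.ext (funext fun v : Spec L A => v.map_T r a)
  map_bot := Cont.ext (funext fun v : Spec L A => v.map_bot)
  map_top := Cont.ext (funext fun v : Spec L A => v.map_top)

theorem evalHom_injective : Function.Injective (evalHom (L := L) A).toFun := fun _ _ h =>
  spec_ext fun v => congrFun (congrArg Cont.toFun h) v

/-- Since `v` lies in the subspace of its own range, `f v` is a value of `v`, so some element agrees
with `f` at `v` and hence on a basic neighbourhood. Finitely many such neighbourhoods cover the
spectrum, and the local elements are cut off by `T ⊤ (b v)` and joined. -/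
theorem evalHom_surjective : Function.Surjective (evalHom (L := L) A).toFun := by
  classical
  intro f
  have hloc : ∀ v : Spec L A, ∃ a b : A, v.toFun b = ⊤ ∧
      ∀ w : Spec L A, w.toFun b = ⊤ → w.toFun a = f.toFun w := fun v => by
    obtain ⟨a, ha⟩ : f.toFun v ∈ Set.range v.toFun := f.map_sub (specRange v) v fun a => ⟨a, rfl⟩
    have hopen : IsOpen {w : Spec L A | w.toFun a = f.toFun w} := by
      have h := ((isLocallyConstant_apply a).prodMk
        (show IsLocallyConstant (X := Spec L A) f.toFun from f.continuous')).isOpen_fiber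
      have : {w : Spec L A | w.toFun a = f.toFun w}
          = ⋃ r : L, {w : Spec L A | (w.toFun a, f.toFun w) = (r, r)} := by
        ext w
        simp only [Set.mem_ofPred_eq, Set.mem_iUnion, Prod.mk.injEq]
        exact ⟨fun h => ⟨_, h, rfl⟩, fun ⟨r, h1, h2⟩ => h1.trans h2.symm⟩
      rw [this]
      exact isOpen_iUnion fun r => h (r, r)
    obtain ⟨_, ⟨b, rfl⟩, hvb, hb⟩ := isTopologicalBasis_spec.exists_subset_of_mem_open ha hopen
    exact ⟨a, b, hvb, fun w hw => hb hw⟩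
  choose a b hb hab using hloc
  obtain ⟨t, ht⟩ := isCompact_univ.elim_finite_subcover
    (fun v : Spec L A => {w : Spec L A | w.toFun (b v) = ⊤}) (fun v => isOpen_apply_eq_top _)
    fun v _ => Set.mem_iUnion.2 ⟨v, hb v⟩
  refine ⟨t.sup fun v => T (⊤ : L) (b v) ⊓ a v, Cont.ext (funext fun w : Spec L A => ?_)⟩
  change w.toFun _ = f.toFun w
  rw [w.map_finset_sup]
  refine le_antisymm (Finset.sup_le fun v _ => ?_) ?_
  · rw [w.map_inf]
    by_cases h : w.toFun (b v) = ⊤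
    · exact inf_le_right.trans (hab v w h).le
    · have : w.toFun (T (⊤ : L) (b v)) = ⊥ := by
        rw [w.map_T]
        exact if_neg h
      rw [this, bot_inf_eq]
      exact bot_le
  · obtain ⟨v, hv, hw⟩ := Set.mem_iUnion₂.1 (ht (Set.mem_univ w))
    refine le_trans ?_ (Finset.le_sup hv)
    rw [w.map_inf, (apply_T_eq_top_iff w ⊤ (b v)).2 hw, top_inf_eq, hab v w hw]

end SpecSpace

/-! ### Clopen indicators and the spectrum as a relational space -/

section Indicator

variable {L : Type u} [HeytingAlgebra L] [Fintype L]

open scoped Classical in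
/-- The function with value `r` on a clopen set `X` and `⊥` elsewhere. -/
noncomputable def Cont.indicator {S : BoolSpace L} (X : Set S.carrier) (hX : IsClopen X) (r : L)
    (hr : ∀ (M : Subalg L), ∀ s ∈ X, s ∈ S.sub M → r ∈ M.carrier) : Cont S where
  toFun s := if s ∈ X then r else ⊥
  continuous' := by
    refine (IsLocallyConstant.iff_eventually_eq _).2 fun s => ?_
    by_cases h : s ∈ X
    · filter_upwards [hX.isOpen.mem_nhds h] with t ht
      rw [if_pos h, if_pos ht]
    · filter_upwards [hX.compl.isOpen.mem_nhds h] with t ht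
      rw [if_neg h, if_neg ht]
  map_sub M s hs := by
    split_ifs with h
    · exact hr M s h hs
    · exact M.bot_mem

variable [Nontrivial L]

/-- The spectrum of an `L`-ML-algebra as an `L`-relational space. -/
def specRelSpace (A : Type u) [HeytingAlgebra A] [MLAlgebra L A] : RelSpace L where
  toBoolSpace := specBoolSpace L A
  rel := specRel (L := L) (A := A)
  rel_of_box v w h := specRel_iff.2 fun a ha =>
    h ((evalHom A).toFun a) (top_le_iff.1 ((le_boxFun _ _ _ _).2
      ((le_apply_box_iff (L := L) v ⊤ a).1 ha.ge)))
  isClopen_preimage X hX := by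
    classical
    -- The clopen set `X` is where some two-valued `a` is 1, so its preimage is where `□ ¬a` is not
    -- 1.
    obtain ⟨a, ha⟩ := evalHom_surjective (L := L) (A := A)
      (Cont.indicator X hX ⊤ fun M _ _ _ => M.top_mem)
    have hmem : ∀ w : Spec L A, w ∈ X ↔ ¬ ⊤ ≤ w.toFun (a ⇨ ⊥) := fun w => by
      have hw : w.toFun a = (Cont.indicator (S := specBoolSpace L A) X hX ⊤
        fun M _ _ _ => M.top_mem).toFun w := congrFun (congrArg Cont.toFun ha) w
      rw [w.map_himp, hw, w.map_bot]
      change w ∈ X ↔ ¬ ⊤ ≤ (if w ∈ X then (⊤ : L) else ⊥) ⇨ ⊥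
      split_ifs with h <;> simp [h]
    have : {v : Spec L A | ∃ w ∈ X, specRel v w}
        = {v : Spec L A | v.toFun (MLAlgebra.box L (a ⇨ ⊥)) ∈ ({⊤}ᶜ : Set L)} := by
      ext v
      have h := le_apply_box_iff v ⊤ (a ⇨ ⊥)
      rw [Set.mem_ofPred_eq, Set.mem_ofPred_eq, Set.mem_compl_singleton_iff, Ne, ← top_le_iff, h]
      push Not
      exact ⟨fun ⟨w, hw, hvw⟩ => ⟨w, hvw, (hmem w).1 hw⟩,
        fun ⟨w, hvw, hw⟩ => ⟨w, (hmem w).2 hw, hvw⟩⟩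
    exact this ▸ isClopen_apply_mem _ _
  rel_sub M v w hv hvw := specRel_mem_specSub hv hvw

end Indicator

/-! ### Functoriality of the spectrum -/

section Functor

variable (L : Type u) [HeytingAlgebra L] [Fintype L] [Nontrivial L]

/-- The contravariant functor `A ↦ Spec A`, `φ ↦ (v ↦ v ∘ φ)`. -/
noncomputable def specFunctor : (MLCat L)ᵒᵖ ⥤ RelSpace L where
  obj A := specRelSpace A.unop.carrier
  map {A B} f :=
    ({toFun := fun v : Spec L A.unop.carrier => VLHom.comp v (MLHom.toVLHom f.unop)
      continuous' := by
        refine continuous_generateFrom_iff.2 ?_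
        rintro _ ⟨a, rfl⟩
        exact isOpen_apply_eq_top ((MLHom.toVLHom f.unop).toFun a)
      map_sub := fun _ _ h a => h _
      map_rel := fun v w h r a hr => h r _ (by rwa [← MLHom.map_box])
      lift_rel := fun v w h => exists_specRel_lift f.unop v w h } :
      RelSpaceHom L (specRelSpace A.unop.carrier) (specRelSpace B.unop.carrier))

end Functor

/-! ### Algebras and their double duals -/

section UnitIso

variable {L : Type u} [HeytingAlgebra L] [Fintype L]

/-- A bijective homomorphism of `L`-ML-algebras is an isomorphism. -/
noncomputable def isoOfBijective {A B : MLCat L} (f : MLHom L A.carrier B.carrier)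
    (hf : Function.Bijective f.toFun) : A ≅ B where
  hom := f
  inv :=
    { toFun := (Equiv.ofBijective _ hf).symm
      map_sup := fun x y => hf.1 (by simp [f.map_sup, Equiv.ofBijective_apply_symm_apply _ hf])
      map_inf := fun x y => hf.1 (by simp [f.map_inf, Equiv.ofBijective_apply_symm_apply _ hf])
      map_himp := fun x y => hf.1 (by simp [f.map_himp, Equiv.ofBijective_apply_symm_apply _ hf])
      map_T := fun r x => hf.1 (by simp [f.map_T, Equiv.ofBijective_apply_symm_apply _ hf])
      map_bot := hf.1 (by simp [f.map_bot, Equiv.ofBijective_apply_symm_apply _ hf])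
      map_top := hf.1 (by simp [f.map_top, Equiv.ofBijective_apply_symm_apply _ hf])
      map_box := fun x => hf.1 (by simp [f.map_box, Equiv.ofBijective_apply_symm_apply _ hf]) }
  hom_inv_id := MLHom.ext (funext fun x => (Equiv.ofBijective _ hf).symm_apply_apply x)
  inv_hom_id := MLHom.ext (funext fun x => (Equiv.ofBijective _ hf).apply_symm_apply x)

variable [Nontrivial L]

/-- Evaluation as a homomorphism of `L`-ML-algebras. -/
def evalMLHom (A : Type u) [HeytingAlgebra A] [MLAlgebra L A] :
    MLHom L A (Cont (specRelSpace (L := L) A).toBoolSpace) where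
  toVLHom := evalHom A
  map_box a := Cont.ext (funext fun v : Spec L A => eq_of_forall_le_iff fun r =>
    (le_apply_box_iff v r a).trans (le_boxFun (specRel (L := L) (A := A)) _ v r).symm)

/-- An `L`-ML-algebra is naturally isomorphic to the algebra of its double dual. -/
noncomputable def unitIso : 𝟭 (MLCat L)ᵒᵖ ≅ specFunctor L ⋙ contFunctor L :=
  (NatIso.ofComponents (F := specFunctor L ⋙ contFunctor L) (G := 𝟭 (MLCat L)ᵒᵖ)
    (fun A => (isoOfBijective (A := A.unop)
      (B := ⟨Cont (specRelSpace (L := L) A.unop.carrier).toBoolSpace⟩)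
      (evalMLHom A.unop.carrier) ⟨evalHom_injective, evalHom_surjective⟩).op)
    (fun _ => rfl)).symm

end UnitIso

/-! ### Spaces and their double duals -/

section CounitIso

variable {L : Type u} [HeytingAlgebra L] [Fintype L]

/-- Evaluation at a point. -/
def evalAt (S : BoolSpace L) (s : S.carrier) : Spec L (Cont S) where
  toFun f := f.toFun s
  map_sup _ _ := rfl
  map_inf _ _ := rfl
  map_himp _ _ := rfl
  map_T _ _ := rfl
  map_bot := rfl
  map_top := rfl

variable {S : BoolSpace L}

/-- Each point lies in a least distinguished subspace. -/
theorem exists_least_sub (s : S.carrier) :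
    ∃ M : Subalg L, s ∈ S.sub M ∧ ∀ N, s ∈ S.sub N → M.carrier ⊆ N.carrier := by
  -- A minimal choice exists because `L` is finite; preservation of binary intersections makes it
  -- least.
  obtain ⟨M, hM, hmin⟩ := (InvImage.wf (Subalg.carrier (L := L))
    (wellFounded_lt (α := Set L))).has_min {M | s ∈ S.sub M} 
    ⟨⊤, show s ∈ S.sub ⊤ from S.sub_top ▸ trivial⟩
  refine ⟨M, hM, fun N hN => ?_⟩
  have h := hmin (M ⊓ N) (show s ∈ S.sub (M ⊓ N) from S.sub_inf M N ▸ ⟨hM, hN⟩)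
  by_contra hMN
  exact h ⟨Set.inter_subset_left, fun h => hMN (h.trans Set.inter_subset_right)⟩

theorem mem_sub_of_carrier_subset {M N : Subalg L} (h : M.carrier ⊆ N.carrier) {s : S.carrier}
    (hs : s ∈ S.sub M) : s ∈ S.sub N := by
  have : M ⊓ N = M := Subalg.ext (Set.inter_eq_left.2 h)
  rw [← this, S.sub_inf] at hs
  exact hs.2

instance : Finite (Subalg L) :=
  Finite.of_injective Subalg.carrier fun _ _ => Subalg.ext

/-- Let `N` be the least subalgebra whose subspace contains `s`. Each `r ∈ N` is the value at `s` of
some function in `Cont S`, so if all values at `s` lie in `M` then `N ⊆ M`. -/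
theorem mem_sub_iff_evalAt (M : Subalg L) (s : S.carrier) :
    s ∈ S.sub M ↔ evalAt S s ∈ specSub (Cont S) M := by
  classical
  refine ⟨fun h f => f.map_sub M s h, fun h => ?_⟩
  obtain ⟨N, hN, hleast⟩ := exists_least_sub s
  refine mem_sub_of_carrier_subset (fun r hr => ?_) hN
  -- Near `s`, a point lies only in subspaces that also contain `s`. Their subalgebras contain `N`,
  -- so the indicator with value `r` is admissible there.
  have hopen : IsOpen (⋂ K : {K : Subalg L // s ∉ S.sub K}, (S.sub K.1)ᶜ) :=
    isOpen_iInter_of_finite fun K => (S.isClosed_sub K.1).isOpen_compl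
  obtain ⟨X, hX, hsX, hXs⟩ := S.zeroDim.exists_subset_of_mem_open
    (Set.mem_iInter.2 fun K => K.2) hopen
  have := h (Cont.indicator X hX r fun K t ht htK => hleast K (by
    by_contra hK
    exact Set.mem_iInter.1 (hXs ht) ⟨K, hK⟩ htK) hr)
  change (if s ∈ X then r else ⊥) ∈ M.carrier at this
  rwa [if_pos hsX] at this

theorem continuous_evalAt : Continuous (evalAt S) := by
  refine continuous_generateFrom_iff.2 ?_
  rintro _ ⟨f, rfl⟩
  exact f.continuous' {⊤}

theorem rel_iff_specRel_evalAt (S : RelSpace L) (s t : S.carrier) :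
    S.rel s t ↔ specRel (evalAt S.toBoolSpace s) (evalAt S.toBoolSpace t) :=
  ⟨fun h r _ hr => (le_boxFun _ _ _ r).1 hr t h, fun h =>
    S.rel_of_box s t fun f hf => top_le_iff.1 (h ⊤ f hf.ge)⟩

variable [Nontrivial L]

theorem evalAt_injective : Function.Injective (evalAt S) := by
  classical
  intro s t hst
  by_contra hne
  obtain ⟨X, hX, hsX, hXt⟩ := S.zeroDim.exists_subset_of_mem_open
    (show s ∈ ({t}ᶜ : Set S.carrier) from hne) isOpen_compl_singleton
  have h : (if s ∈ X then (⊤ : L) else ⊥) = if t ∈ X then ⊤ else ⊥ :=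
    congrArg (fun v : Spec L (Cont S) =>
      v.toFun (Cont.indicator X hX ⊤ fun M _ _ _ => M.top_mem)) hst
  rw [if_pos hsX, if_neg fun ht => hXt ht rfl] at h
  exact top_ne_bot h

/-- The closed sets where `f` takes the value `v f` have the finite intersection property: otherwise
a finite meet of elements `T (v f) f` would be 0, while `v` sends it to 1. By compactness they share
a point. -/
theorem evalAt_surjective : Function.Surjective (evalAt S) := by
  classical
  intro v
  have hclosed : ∀ f : Cont S, IsClosed {s | f.toFun s = v.toFun f} := fun f =>
    ⟨f.continuous' {v.toFun f}ᶜ⟩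
  have hne : (Set.univ ∩ ⋂ f : Cont S, {s | f.toFun s = v.toFun f}).Nonempty := by
    refine isCompact_univ.inter_iInter_nonempty _ hclosed fun t => ?_
    by_contra hempty
    have hbot : (t.inf fun f => T (v.toFun f) f) = (⊥ : Cont S) := by
      refine Cont.ext (funext fun s => ?_)
      obtain ⟨f, hf, hs⟩ : ∃ f ∈ t, f.toFun s ≠ v.toFun f := by
        by_contra! h
        exact hempty ⟨s, trivial, Set.mem_iInter₂.2 h⟩
      rw [Cont.inf_apply]
      refine le_bot_iff.1 ((Finset.inf_le hf).trans ?_)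
      exact (if_neg hs).le
    have htop : v.toFun (t.inf fun f => T (v.toFun f) f) = ⊤ := by
      rw [Finset.apply_inf_eq_inf_comp v.toFun v.map_inf v.map_top]
      exact top_le_iff.1 (Finset.le_inf fun f _ => ((apply_T_eq_top_iff v _ f).2 rfl).ge)
    rw [hbot, v.map_bot] at htop
    exact bot_ne_top htop
  obtain ⟨s, -, hs⟩ := hne
  exact ⟨s, VLHom.ext (funext fun f => Set.mem_iInter.1 hs f)⟩

/-- An `L`-relational space is isomorphic to the spectrum of its algebra of functions. -/
noncomputable def evalAtIso (S : RelSpace L) :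
    S ≅ specRelSpace (L := L) (Cont S.toBoolSpace) :=
  let e : S.carrier ≃ₜ Spec L (Cont S.toBoolSpace) :=
    Continuous.homeoOfEquivCompactToT2
      (f := Equiv.ofBijective (evalAt S.toBoolSpace) ⟨evalAt_injective, evalAt_surjective⟩)
      continuous_evalAt
  have hsub : ∀ (M : Subalg L) s, s ∈ S.sub M ↔ e s ∈ specSub (Cont S.toBoolSpace) M :=
    mem_sub_iff_evalAt
  have hrel : ∀ s t, S.rel s t ↔ specRel (e s) (e t) := rel_iff_specRel_evalAt S
  { hom :=
      ({toFun := e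
        continuous' := e.continuous
        map_sub := fun M s => (hsub M s).1
        map_rel := fun s t => (hrel s t).1
        lift_rel := fun s (v : Spec L (Cont S.toBoolSpace)) h => ⟨e.symm v, (hrel _ _).2 (by rwa [e.apply_symm_apply]),
          e.apply_symm_apply v⟩ } : RelSpaceHom L S (specRelSpace (Cont S.toBoolSpace)))
    inv :=
      ({toFun := e.symm
        continuous' := e.symm.continuous
        map_sub := fun M (v : Spec L (Cont S.toBoolSpace)) h => (hsub M _).2 (by rwa [e.apply_symm_apply])
        map_rel := fun (v w : Spec L (Cont S.toBoolSpace)) h => (hrel _ _).2 (by rwa [e.apply_symm_apply, e.apply_symm_apply])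
        lift_rel := fun (v : Spec L (Cont S.toBoolSpace)) s h => ⟨e s, by
          have := (hrel _ _).1 h
          rwa [e.apply_symm_apply] at this, e.symm_apply_apply s⟩ } :
        RelSpaceHom L (specRelSpace (Cont S.toBoolSpace)) S)
    hom_inv_id := RelSpaceHom.ext (funext e.symm_apply_apply)
    inv_hom_id := RelSpaceHom.ext (funext e.apply_symm_apply) }

/-- An `L`-relational space is naturally isomorphic to its double dual. -/
noncomputable def counitIso : contFunctor L ⋙ specFunctor L ≅ 𝟭 (RelSpace L) :=
  (NatIso.ofComponents (fun S => evalAtIso S) (fun _ => rfl)).symm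

end CounitIso

end FittingDuality

theorem mainTheorem1 (L : Type u) [HeytingAlgebra L] [Fintype L] [Nontrivial L] :
    ∃ (e : (MLCat L)ᵒᵖ ≌ RelSpace L)
      (h : ∀ A : MLCat L, (e.functor.obj (Opposite.op A)).carrier ≃ₜ Spec L A.carrier),
      (∀ (A : MLCat L) (M : Subalg L) (s : (e.functor.obj (Opposite.op A)).carrier),
        s ∈ (e.functor.obj (Opposite.op A)).sub M ↔ h A s ∈ specSub A.carrier M) ∧
      (∀ (A : MLCat L) (s t : (e.functor.obj (Opposite.op A)).carrier),
        (e.functor.obj (Opposite.op A)).rel s t ↔ specRel (h A s) (h A t)) ∧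
      (∀ (A B : MLCat L) (φ : A ⟶ B) (s : (e.functor.obj (Opposite.op B)).carrier),
        h A (RelSpaceHom.toFun (e.functor.map φ.op) s) = (h B s).comp (MLHom.toVLHom φ)) ∧
      Nonempty (e.inverse ≅ contFunctor L) :=
  -- `Equivalence.mk` adjusts only the natural isomorphisms, so both functors stay the given ones
  -- and all comparison maps are identities.
  ⟨CategoryTheory.Equivalence.mk (specFunctor L) (contFunctor L) unitIso counitIso,
    fun A => Homeomorph.refl (Spec L A.carrier), fun _ _ _ => Iff.rfl, fun _ _ _ => Iff.rfl,
    fun _ _ _ _ => rfl, ⟨Iso.refl _⟩⟩
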